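/- Let $0<r<1$, $\tfrac12<\beta<1$, $a_1,a_2>0$, $b_2>b_1>0$ and $0<\alpha<\tfrac12$, and suppose that $(\beta,r)$ lies in the interior of the detectable region, that is, $r>\rho^*(\beta)$, where $\rho^*(\beta)=\beta-\tfrac12$ for $\tfrac12<\beta\le\tfrac34$ and $\rho^*(\beta)=(1-\sqrt{1-\beta})^2$ for $\tfrac34<\beta<1$. For $n\ge 2$ put $$\Omega_n=\Big\{(\varepsilon_n,\mu_n): b_1n^{-\beta}\le\varepsilon_n\le b_2n^{-\beta},\ \sqrt{2r\log n}-\tfrac{a_1}{\log n}\le\mu_n\le\sqrt{2r\log n}+\tfrac{a_2}{\log n}\Big\},$$ and for $(\varepsilon_n,\mu_n)\in\Omega_n$ let $X_1,\dots,X_n$ be i.i.d. with law $(1-\varepsilon_n)N(0,1)+\varepsilon_nN(\mu_n,1)$. A $(1-\alpha)$ level lower confidence limit for $\varepsilon_n$ over $\Omega_n$ is a real-valued measurable function $\hat\varepsilon_n=\hat\varepsilon_n(X_1,\dots,X_n)$ with $\inf_{(\varepsilon_n,\mu_n)\in\Omega_n}P\{\varepsilon_n\ge\hat\varepsilon_n\}\ge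 1-\alpha$. Then there is a constant $C>0$, not depending on $n$, such that for every $n\ge2$ with $b_2n^{-\beta}\le 1$ (so that every $\varepsilon_n$ in question is a mixture weight), $$\inf_{\hat\varepsilon_n}\ \sup_{(\varepsilon_n,\mu_n)\in\Omega_n}E\Big(1-\frac{\hat\varepsilon_n}{\varepsilon_n}\Big)_+\ \ge\ \begin{cases}C(\log n)^{1/2}\,n^{-1/2-r+\beta},&\beta\ge3r,\\ C(\log n)^{5/4}\,n^{-1/2+(\beta+r)^2/(8r)},&r<\beta<3r,\\ C\,n^{-1/2+\beta/2},&\beta\le r,\end{cases}$$ where the infimum is over all $(1-\alpha)$ level lower confidence limits $\hat\varepsilon_n$ for $\varepsilon_n$ over $\Omega_n$. -/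

import Mathlib

open MeasureTheory ProbabilityTheory
open scoped ENNReal

noncomputable section

/-- The two-point Gaussian mixture `(1 - ε) N(0, 1) + ε N(μ, 1)` on the line, where `0 ≤ ε ≤ 1`. -/
def gaussianMixture (ε μ : ℝ) : Measure ℝ :=
  ENNReal.ofReal (1 - ε) • gaussianReal 0 1 + ENNReal.ofReal ε • gaussianReal μ 1

/-- The joint law of `X₁, …, Xₙ`, i.i.d. with law `(1 - ε) N(0, 1) + ε N(μ, 1)`;
a parameter is a pair `θ = (ε, μ)`. -/
def sampleLaw (n : ℕ) (θ : ℝ × ℝ) : Measure (Fin n → ℝ) :=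
  Measure.pi fun _ => gaussianMixture θ.1 θ.2

/-- The parameter set `Ωₙ` of pairs `(ε, μ)` with `b₁ n^{-β} ≤ ε ≤ b₂ n^{-β}` and
`√(2 r log n) - a₁ / log n ≤ μ ≤ √(2 r log n) + a₂ / log n`. -/
def paramSet (r β a₁ a₂ b₁ b₂ : ℝ) (n : ℕ) : Set (ℝ × ℝ) :=
  {θ | b₁ * (n : ℝ) ^ (-β) ≤ θ.1 ∧ θ.1 ≤ b₂ * (n : ℝ) ^ (-β) ∧
    √(2 * r * Real.log n) - a₁ / Real.log n ≤ θ.2 ∧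
    θ.2 ≤ √(2 * r * Real.log n) + a₂ / Real.log n}

/-- An estimator `T`, a measurable function of the sample `X₁, …, Xₙ`, is a `(1 - α)` level lower
confidence limit for `ε` over `Ω` if `inf_{(ε, μ) ∈ Ω} P(ε ≥ T) ≥ 1 - α`. -/
def IsLowerConfidenceLimit {n : ℕ} (Ω : Set (ℝ × ℝ)) (α : ℝ) (T : (Fin n → ℝ) → ℝ) : Prop :=
  Measurable T ∧ ENNReal.ofReal (1 - α) ≤ ⨅ θ ∈ Ω, sampleLaw n θ {x | T x ≤ θ.1}

/-- The relative underestimation risk `E (1 - T / ε)₊` at `θ = (ε, μ)`, with values in `[0, ∞]`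
because the expectation need not be finite. -/
def underestimationRisk {n : ℕ} (T : (Fin n → ℝ) → ℝ) (θ : ℝ × ℝ) : ℝ≥0∞ :=
  ∫⁻ x, ENNReal.ofReal (max (1 - T x / θ.1) 0) ∂(sampleLaw n θ)

/-- The detection boundary `ρ*(β)`, for `1/2 < β < 1`. -/
def detectionBoundary (β : ℝ) : ℝ :=
  if β ≤ 3 / 4 then β - 1 / 2 else (1 - √(1 - β)) ^ 2

/-- The rate of the lower bound, in the three regimes `β ≥ 3 r`, `r < β < 3 r` and `β ≤ r`. -/
def lowerRate (r β : ℝ) (n : ℕ) : ℝ :=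
  if 3 * r ≤ β then (Real.log n) ^ (1 / 2 : ℝ) * (n : ℝ) ^ (-(1 / 2) - r + β)
  else if r < β then
    (Real.log n) ^ (5 / 4 : ℝ) * (n : ℝ) ^ (-(1 / 2) + (β + r) ^ 2 / (8 * r))
  else (n : ℝ) ^ (-(1 / 2) + β / 2)

end

/-!
The lower bound is a two-point argument. Let `(ε₀, μ₀)` and `(ε₁, μ₁)`, with `ε₀ < ε₁`, be two
parameters in `Ωₙ` whose sample laws cannot be told apart. A confidence limit is at most `ε₀` with
probability at least `1 - α > 1 / 2` under the first, hence with probability at least `1 / 4` under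
the second, where its relative error is then at least `1 - ε₀ / ε₁`
(`le_underestimationRisk`). Indistinguishability is measured by the chi-square divergence `χ²` of
the marginals: for products `1 + χ²` is raised to the power `n`, so it suffices that `n χ²` is small
(`pi_withDensity_real_ge_sub`).

Take `ε₀ = b₁ n^{-β}`, `μ₀ = √(2 r log n)` and `ε₁ = (1 + δ) ε₀`, and let `L_μ` be the likelihood
ratio of `N(μ, 1)` to `N(0, 1)`. As `n ε₀² ≤ b₁²` for `β > 1/2`, changing the weight of the null
component is harmless (`chiSq_mixtureDensity_le`), and what remains is the integral of
`(ε₁ L_{μ₁} - ε₀ L_{μ₀})² / (1 - ε₀ + ε₀ L_{μ₀})` against the standard normal law. The mean is moved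
to `μ₁ = μ₀ - h` so as to compensate the change of weight at a point `y`: for
`1 + δ = exp (h (y - μ₀ + h / 2))` one has exactly
`ε₁ L_{μ₁}(x) - ε₀ L_{μ₀}(x) = ε₀ L_{μ₀}(x) (exp (-h (x - y)) - 1)`,
which vanishes at `y`, and `δ ≥ h (y - μ₀)` is of the order `h √(log n)`. The point `y` is where the
integral would otherwise concentrate.

* For `β ≥ 3 r` it is `y = 2 μ₀`, and the integral is at most a constant times `ε₀² n^{2r} h²`
  (`integral_signal_le_of_match_two_mul`).
* For `r < β < 3 r` it is `y = (β + r) √(log n) / √(2 r)`, where `L_{μ₀}(y) = n^β`, so that the two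
  components balance. Around `y` the integrand without the factor `(x - y)²` decays exponentially at
  a rate of the order `√(log n)`, and the integral is at most a constant times
  `exp (-y² / 2) h² (log n)^{-3/2}` (`integral_signal_le_of_match`).
* For `β ≤ r` nothing is gained by moving the mean: with `h = 0` and `δ` free the integral is at
  most `ε₀ δ²` (`integral_signal_le_of_same_mean`).

Choosing `h`, respectively `δ`, so that `n` times the bound is a small constant gives the three
rates. The detectability assumption, and `β < 1` when `β ≤ r`, make `h` and `δ` decay like a
negative power of `n`, up to logarithms, which keeps both parameters in `Ωₙ` for every `n ≥ 2`
(`exists_shift_small`).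
-/

open MeasureTheory ProbabilityTheory
open scoped ENNReal

/-! ### Product densities and two-point testing -/

theorem pi_withDensity_ofReal {ι E : Type*} [Fintype ι] [MeasurableSpace E] {γ : Measure E}
    [SigmaFinite γ] {f : E → ℝ} (hf0 : ∀ x, 0 ≤ f x) (hfi : Integrable f γ) :
    Measure.pi (fun _ : ι => γ.withDensity fun x => ENNReal.ofReal (f x)) =
      (Measure.pi fun _ : ι => γ).withDensity fun x => ENNReal.ofReal (∏ i, f (x i)) := by
  have : IsFiniteMeasure (γ.withDensity fun x => ENNReal.ofReal (f x)) :=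
    isFiniteMeasure_withDensity_ofReal hfi.2
  refine Measure.pi_eq fun s hs => ?_
  rw [withDensity_apply _ (MeasurableSet.univ_pi hs), Measure.restrict_pi_pi,
    ← ofReal_integral_eq_lintegral_ofReal
      (Integrable.fintype_prod (f := fun _ => f) fun i => hfi.restrict)
      (Filter.Eventually.of_forall fun x => Finset.prod_nonneg fun i _ => hf0 _),
    integral_fintype_prod_eq_prod (fun _ => f),
    ENNReal.ofReal_prod_of_nonneg fun i _ => integral_nonneg hf0]
  refine Finset.prod_congr rfl fun i _ => ?_
  rw [withDensity_apply _ (hs i), ofReal_integral_eq_lintegral_ofReal hfi.restrict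
    (Filter.Eventually.of_forall hf0)]

/-- Two-point comparison of product measures through the chi-square divergence: if
`n · χ²(f₁ ‖ f₀) ≤ 1 / 32`, then events lose at most `1 / 4` of their probability on passing from
the product law with marginal density `f₀` to the one with marginal density `f₁`. -/
theorem pi_withDensity_real_ge_sub {n : ℕ} {E : Type*} [MeasurableSpace E] {γ : Measure E}
    [IsProbabilityMeasure γ] {f₀ f₁ : E → ℝ} (h0 : ∀ x, 0 < f₀ x) (h1 : ∀ x, 0 ≤ f₁ x)
    (hi0 : Integrable f₀ γ) (hi1 : Integrable f₁ γ) (hI0 : ∫ x, f₀ x ∂γ = 1)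
    (hI1 : ∫ x, f₁ x ∂γ = 1) (hc : Integrable (fun x => (f₁ x - f₀ x) ^ 2 / f₀ x) γ)
    (hn : n * ∫ x, (f₁ x - f₀ x) ^ 2 / f₀ x ∂γ ≤ 1 / 32) {A : Set (Fin n → E)}
    (hA : MeasurableSet A) :
    (Measure.pi fun _ : Fin n => γ.withDensity fun x => ENNReal.ofReal (f₀ x)).real A - 1 / 4 ≤
      (Measure.pi fun _ : Fin n => γ.withDensity fun x => ENNReal.ofReal (f₁ x)).real A := by
  set χ := ∫ x, (f₁ x - f₀ x) ^ 2 / f₀ x ∂γ with hχ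
  have hχ0 : 0 ≤ χ := integral_nonneg fun x => div_nonneg (sq_nonneg _) (h0 x).le
  set Γ := Measure.pi fun _ : Fin n => γ
  set F₀ : (Fin n → E) → ℝ := fun x => ∏ i, f₀ (x i) with hF₀
  set F₁ : (Fin n → E) → ℝ := fun x => ∏ i, f₁ (x i) with hF₁
  have hF0 : ∀ x, 0 < F₀ x := fun x => Finset.prod_pos fun i _ => h0 _
  have hF1 : ∀ x, 0 ≤ F₁ x := fun x => Finset.prod_nonneg fun i _ => h1 _
  have hFi0 : Integrable F₀ Γ := Integrable.fintype_prod (f := fun _ => f₀) fun _ => hi0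
  have hFi1 : Integrable F₁ Γ := Integrable.fintype_prod (f := fun _ => f₁) fun _ => hi1
  have hFI0 : ∫ x, F₀ x ∂Γ = 1 := by
    rw [integral_fintype_prod_eq_pow f₀, hI0, one_pow]
  have hFI1 : ∫ x, F₁ x ∂Γ = 1 := by
    rw [integral_fintype_prod_eq_pow f₁, hI1, one_pow]
  have hsq : ∀ x, f₁ x ^ 2 / f₀ x = (f₁ x - f₀ x) ^ 2 / f₀ x + (2 * f₁ x - f₀ x) := fun x => by
    have := (h0 x).ne'
    field_simp
    ring
  have hi10 : Integrable (fun x => 2 * f₁ x - f₀ x) γ := (hi1.const_mul 2).sub hi0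
  have hgi : Integrable (fun x => f₁ x ^ 2 / f₀ x) γ := by
    simp_rw [hsq]
    exact hc.add hi10
  have hgI : ∫ x, f₁ x ^ 2 / f₀ x ∂γ = 1 + χ := by
    simp_rw [hsq]
    rw [integral_add hc hi10, integral_sub (hi1.const_mul 2) hi0,
      integral_const_mul, hI0, hI1]
    ring
  set G : (Fin n → E) → ℝ := fun x => ∏ i, f₁ (x i) ^ 2 / f₀ (x i) with hG
  have hGi : Integrable G Γ :=
    Integrable.fintype_prod (f := fun _ x => f₁ x ^ 2 / f₀ x) fun _ => hgi
  have hGI : ∫ x, G x ∂Γ ≤ 17 / 16 := by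
    rw [integral_fintype_prod_eq_pow fun x => f₁ x ^ 2 / f₀ x, hgI, Fintype.card_fin]
    calc (1 + χ) ^ n ≤ Real.exp χ ^ n := by
          gcongr
          linarith [Real.add_one_le_exp χ]
      _ = Real.exp (n * χ) := (Real.exp_nat_mul _ _).symm
      _ ≤ Real.exp (1 / 32) := Real.exp_le_exp.2 hn
      _ ≤ 17 / 16 := by
          have := Real.abs_exp_sub_one_sub_id_le (x := 1 / 32) (by norm_num [abs_of_pos])
          have := (abs_le.1 this).2
          norm_num at this ⊢
          linarith
  have hGeq : ∀ x, G x = F₁ x ^ 2 / F₀ x := fun x => by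
    simp only [hG, hF₀, hF₁, Finset.prod_div_distrib, Finset.prod_pow]
  -- `F₀ - F₁ ≤ 2 (F₁ - F₀)² / F₀ + F₀ / 8` by the inequality of means
  have hpt : ∀ x, F₀ x - F₁ x ≤ 2 * G x - 4 * F₁ x + 2 * F₀ x + F₀ x / 8 := fun x => by
    rw [hGeq]
    have h := hF0 x
    have : 2 * (F₁ x ^ 2 / F₀ x) - 4 * F₁ x + 2 * F₀ x + F₀ x / 8 - (F₀ x - F₁ x) =
        2 * (F₁ x - F₀ x + F₀ x / 4) ^ 2 / F₀ x := by
      field_simp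
      ring
    have h2 : 0 ≤ 2 * (F₁ x - F₀ x + F₀ x / 4) ^ 2 / F₀ x := by positivity
    linarith
  have hpt0 : ∀ x, 0 ≤ 2 * G x - 4 * F₁ x + 2 * F₀ x + F₀ x / 8 := fun x => by
    rw [hGeq]
    have h := hF0 x
    have : 2 * (F₁ x ^ 2 / F₀ x) - 4 * F₁ x + 2 * F₀ x + F₀ x / 8 =
        2 * (F₁ x - F₀ x) ^ 2 / F₀ x + F₀ x / 8 := by
      field_simp
      ring
    rw [this]
    positivity
  have hj : Integrable (fun x => 2 * G x - 4 * F₁ x) Γ :=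
    (hGi.const_mul 2).sub (hFi1.const_mul 4)
  have hk : Integrable (fun x => 2 * G x - 4 * F₁ x + 2 * F₀ x) Γ := hj.add (hFi0.const_mul 2)
  have hi : Integrable (fun x => 2 * G x - 4 * F₁ x + 2 * F₀ x + F₀ x / 8) Γ :=
    hk.add (hFi0.div_const 8)
  have key : ∫ x in A, F₀ x ∂Γ - ∫ x in A, F₁ x ∂Γ ≤ 1 / 4 := by
    rw [← integral_sub hFi0.integrableOn hFi1.integrableOn]
    calc ∫ x in A, F₀ x - F₁ x ∂Γ
        ≤ ∫ x in A, 2 * G x - 4 * F₁ x + 2 * F₀ x + F₀ x / 8 ∂Γ :=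
          integral_mono (hFi0.sub hFi1).integrableOn hi.integrableOn hpt
      _ ≤ ∫ x, 2 * G x - 4 * F₁ x + 2 * F₀ x + F₀ x / 8 ∂Γ :=
          setIntegral_le_integral hi (Filter.Eventually.of_forall hpt0)
      _ = 2 * ∫ x, G x ∂Γ - 4 + 2 + 1 / 8 := by
          rw [integral_add hk (hFi0.div_const 8), integral_add hj (hFi0.const_mul 2),
            integral_sub (hGi.const_mul 2) (hFi1.const_mul 4), integral_const_mul,
            integral_const_mul, integral_const_mul, integral_div, hFI0, hFI1]
          ring
      _ ≤ 1 / 4 := by linarith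
  have hreal : ∀ f : E → ℝ, (∀ x, 0 ≤ f x) → Integrable f γ →
      (Measure.pi fun _ : Fin n => γ.withDensity fun x => ENNReal.ofReal (f x)).real A =
        ∫ x in A, ∏ i, f (x i) ∂Γ := fun f hf hfi => by
    rw [pi_withDensity_ofReal hf hfi, measureReal_def, withDensity_apply _ hA,
      ← ofReal_integral_eq_lintegral_ofReal
        (Integrable.fintype_prod (f := fun _ => f) fun _ => hfi).integrableOn
        (Filter.Eventually.of_forall fun x => Finset.prod_nonneg fun i _ => hf _),
      ENNReal.toReal_ofReal (integral_nonneg fun x => Finset.prod_nonneg fun i _ => hf _)]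
  rw [hreal f₀ (fun x => (h0 x).le) hi0, hreal f₁ h1 hi1]
  linarith

/-! ### Densities of Gaussian mixtures -/

/-- The likelihood ratio `dN(μ, 1) / dN(0, 1)`. -/
noncomputable def gaussianLR (μ x : ℝ) : ℝ := Real.exp (μ * x - μ ^ 2 / 2)

/-- The density of `(1 - ε) N(0, 1) + ε N(μ, 1)` with respect to `N(0, 1)`. -/
noncomputable def mixtureDensity (ε μ x : ℝ) : ℝ := 1 - ε + ε * gaussianLR μ x

theorem gaussianLR_pos (μ x : ℝ) : 0 < gaussianLR μ x := Real.exp_pos _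

@[fun_prop]
theorem measurable_gaussianLR (μ : ℝ) : Measurable (gaussianLR μ) := by
  unfold gaussianLR
  fun_prop

theorem integral_exp_mul_gaussianReal (t : ℝ) :
    ∫ x, Real.exp (t * x) ∂(gaussianReal 0 1) = Real.exp (t ^ 2 / 2) := by
  have := mgf_gaussianReal (p := gaussianReal 0 1) (X := id) (Measure.map_id) t
  simpa [mgf] using this

theorem gaussianLR_eq (μ x : ℝ) :
    gaussianLR μ x = Real.exp (-(μ ^ 2 / 2)) * Real.exp (μ * x) := by
  rw [gaussianLR, ← Real.exp_add]
  ring_nf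

theorem integrable_gaussianLR (μ : ℝ) : Integrable (gaussianLR μ) (gaussianReal 0 1) := by
  have : gaussianLR μ = fun x => Real.exp (-(μ ^ 2 / 2)) * Real.exp (μ * x) :=
    funext (gaussianLR_eq μ)
  rw [this]
  exact (integrable_exp_mul_gaussianReal μ).const_mul _

theorem integral_gaussianLR (μ : ℝ) : ∫ x, gaussianLR μ x ∂(gaussianReal 0 1) = 1 := by
  simp_rw [gaussianLR_eq]
  rw [integral_const_mul, integral_exp_mul_gaussianReal, ← Real.exp_add]
  simp

theorem gaussianReal_eq_withDensity_gaussianLR (μ : ℝ) :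
    gaussianReal μ 1 =
      (gaussianReal 0 1).withDensity fun x => ENNReal.ofReal (gaussianLR μ x) := by
  rw [gaussianReal_of_var_ne_zero _ one_ne_zero, gaussianReal_of_var_ne_zero _ one_ne_zero,
    ← withDensity_mul _ (measurable_gaussianPDF 0 1) (by fun_prop)]
  congr 1
  ext x
  rw [Pi.mul_apply, gaussianPDF, gaussianPDF,
    ← ENNReal.ofReal_mul (gaussianPDFReal_nonneg 0 1 x), gaussianPDFReal, gaussianPDFReal,
    mul_assoc _ (Real.exp _), gaussianLR, ← Real.exp_add]
  congr 3
  push_cast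
  ring

theorem integrable_mixtureDensity (ε μ : ℝ) :
    Integrable (mixtureDensity ε μ) (gaussianReal 0 1) :=
  (integrable_const _).add ((integrable_gaussianLR μ).const_mul ε)

theorem integral_mixtureDensity (ε μ : ℝ) :
    ∫ x, mixtureDensity ε μ x ∂(gaussianReal 0 1) = 1 := by
  unfold mixtureDensity
  rw [integral_add (integrable_const _) ((integrable_gaussianLR μ).const_mul ε),
    integral_const_mul, integral_gaussianLR]
  simp

theorem mixtureDensity_nonneg {ε : ℝ} (h0 : 0 ≤ ε) (h1 : ε ≤ 1) (μ x : ℝ) :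
    0 ≤ mixtureDensity ε μ x :=
  add_nonneg (by linarith) (mul_nonneg h0 (gaussianLR_pos _ _).le)

theorem gaussianMixture_eq_withDensity {ε : ℝ} (h0 : 0 ≤ ε) (h1 : ε ≤ 1) (μ : ℝ) :
    gaussianMixture ε μ =
      (gaussianReal 0 1).withDensity fun x => ENNReal.ofReal (mixtureDensity ε μ x) := by
  have : (fun x => ENNReal.ofReal (mixtureDensity ε μ x)) =
      (fun _ => ENNReal.ofReal (1 - ε)) +
        ENNReal.ofReal ε • fun x => ENNReal.ofReal (gaussianLR μ x) := by
    ext x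
    rw [mixtureDensity, ENNReal.ofReal_add (by linarith)
      (mul_nonneg h0 (gaussianLR_pos _ _).le), ENNReal.ofReal_mul h0]
    rfl
  rw [this, withDensity_add_left measurable_const, withDensity_const,
    withDensity_smul _ (by fun_prop), ← gaussianReal_eq_withDensity_gaussianLR, gaussianMixture]

theorem le_mixtureDensity {ε₀ w : ℝ} (hε₀ : 0 ≤ ε₀) (hw1 : w ≤ 1 - ε₀) (μ x : ℝ) :
    w ≤ mixtureDensity ε₀ μ x := by
  have := mul_nonneg hε₀ (gaussianLR_pos μ x).le
  unfold mixtureDensity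
  linarith

/-- Only the signal part of the difference of two mixture densities matters for their chi-square
divergence: the change of weight costs at most `2 (ε₁ - ε₀)² / w`. -/
theorem chiSq_mixtureDensity_le {ε₀ ε₁ μ₀ μ₁ w M : ℝ} (hε₀ : 0 ≤ ε₀) (hw : 0 < w)
    (hw1 : w ≤ 1 - ε₀)
    (hi : Integrable (fun x => (ε₁ * gaussianLR μ₁ x - ε₀ * gaussianLR μ₀ x) ^ 2 /
      mixtureDensity ε₀ μ₀ x) (gaussianReal 0 1))
    (hM : ∫ x, (ε₁ * gaussianLR μ₁ x - ε₀ * gaussianLR μ₀ x) ^ 2 /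
      mixtureDensity ε₀ μ₀ x ∂(gaussianReal 0 1) ≤ M) :
    Integrable (fun x => (mixtureDensity ε₁ μ₁ x - mixtureDensity ε₀ μ₀ x) ^ 2 /
      mixtureDensity ε₀ μ₀ x) (gaussianReal 0 1) ∧
    ∫ x, (mixtureDensity ε₁ μ₁ x - mixtureDensity ε₀ μ₀ x) ^ 2 /
      mixtureDensity ε₀ μ₀ x ∂(gaussianReal 0 1) ≤ 2 * M + 2 * (ε₁ - ε₀) ^ 2 / w := by
  have hwd := le_mixtureDensity hε₀ hw1 μ₀
  have hle : ∀ x, (mixtureDensity ε₁ μ₁ x - mixtureDensity ε₀ μ₀ x) ^ 2 /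
      mixtureDensity ε₀ μ₀ x ≤ 2 * ((ε₁ * gaussianLR μ₁ x - ε₀ * gaussianLR μ₀ x) ^ 2 /
      mixtureDensity ε₀ μ₀ x) + 2 * (ε₁ - ε₀) ^ 2 / w := fun x => by
    have hp : 0 < mixtureDensity ε₀ μ₀ x := hw.trans_le (hwd x)
    calc _ ≤ (2 * (ε₁ * gaussianLR μ₁ x - ε₀ * gaussianLR μ₀ x) ^ 2 + 2 * (ε₁ - ε₀) ^ 2) /
          mixtureDensity ε₀ μ₀ x := by
          gcongr
          unfold mixtureDensity
          nlinarith [sq_nonneg ((ε₁ * gaussianLR μ₁ x - ε₀ * gaussianLR μ₀ x) + (ε₁ - ε₀))]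
      _ = 2 * ((ε₁ * gaussianLR μ₁ x - ε₀ * gaussianLR μ₀ x) ^ 2 / mixtureDensity ε₀ μ₀ x) +
          2 * (ε₁ - ε₀) ^ 2 / mixtureDensity ε₀ μ₀ x := by ring
      _ ≤ _ := by
          gcongr
          exact hwd x
  have hi2 := (hi.const_mul 2).add (integrable_const (μ := gaussianReal 0 1)
    (2 * (ε₁ - ε₀) ^ 2 / w))
  have hi3 : Integrable (fun x => (mixtureDensity ε₁ μ₁ x - mixtureDensity ε₀ μ₀ x) ^ 2 /
      mixtureDensity ε₀ μ₀ x) (gaussianReal 0 1) := by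
    refine hi2.mono' ?_ (Filter.Eventually.of_forall fun x => ?_)
    · unfold mixtureDensity
      exact Measurable.aestronglyMeasurable (by fun_prop)
    · have hp : 0 < mixtureDensity ε₀ μ₀ x := hw.trans_le (hwd x)
      rw [Real.norm_of_nonneg (by positivity)]
      exact hle x
  refine ⟨hi3, (integral_mono hi3 hi2 hle).trans ?_⟩
  simp only [Pi.add_apply]
  rw [integral_add (hi.const_mul 2) (integrable_const _), integral_const_mul]
  simp only [integral_const, probReal_univ, one_smul]
  linarith

/-! ### Reduction to a pair of parameters -/

/-- If `θ₀, θ₁ ∈ Ω` cannot be told apart, a limit that is below `ε₀` with probability at least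
`1 - α` under `θ₀` is below `ε₀` with probability at least `1 / 4` under `θ₁`, and there it
underestimates `ε₁` by the factor `ε₀ / ε₁`. -/
theorem le_underestimationRisk {n : ℕ} {Ω : Set (ℝ × ℝ)} {α : ℝ} (hα1 : α < 1 / 2)
    {T : (Fin n → ℝ) → ℝ} (hT : IsLowerConfidenceLimit Ω α T) {ε₀ ε₁ μ₀ μ₁ : ℝ}
    (hε₀ : 0 < ε₀) (h01 : ε₀ < ε₁) (hε₁ : ε₁ ≤ 1) (hθ : (ε₀, μ₀) ∈ Ω)
    (hi : Integrable (fun x => (mixtureDensity ε₁ μ₁ x - mixtureDensity ε₀ μ₀ x) ^ 2 /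
      mixtureDensity ε₀ μ₀ x) (gaussianReal 0 1))
    (hn : n * ∫ x, (mixtureDensity ε₁ μ₁ x - mixtureDensity ε₀ μ₀ x) ^ 2 /
      mixtureDensity ε₀ μ₀ x ∂(gaussianReal 0 1) ≤ 1 / 32) :
    ENNReal.ofReal ((1 - ε₀ / ε₁) / 4) ≤ underestimationRisk T (ε₁, μ₁) := by
  have hA : MeasurableSet {x | T x ≤ ε₀} := hT.1 measurableSet_Iic
  have hcov : ENNReal.ofReal (1 - α) ≤ sampleLaw n (ε₀, μ₀) {x | T x ≤ ε₀} :=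
    hT.2.trans (iInf₂_le (ε₀, μ₀) hθ)
  have hpos : ∀ x, 0 < mixtureDensity ε₀ μ₀ x := fun x =>
    add_pos (by linarith) (mul_pos hε₀ (gaussianLR_pos _ _))
  have key := pi_withDensity_real_ge_sub hpos (mixtureDensity_nonneg (hε₀.trans h01).le hε₁ μ₁)
    (integrable_mixtureDensity _ _) (integrable_mixtureDensity _ _)
    (integral_mixtureDensity _ _) (integral_mixtureDensity _ _) hi hn hA
  rw [← gaussianMixture_eq_withDensity hε₀.le (by linarith),
    ← gaussianMixture_eq_withDensity (hε₀.trans h01).le hε₁] at key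
  change (sampleLaw n (ε₀, μ₀)).real _ - _ ≤ (sampleLaw n (ε₁, μ₁)).real _ at key
  have hfin : ∀ {ε μ : ℝ}, 0 ≤ ε → ε ≤ 1 → IsFiniteMeasure (sampleLaw n (ε, μ)) := by
    intro ε μ h0 h1
    unfold sampleLaw
    rw [gaussianMixture_eq_withDensity h0 h1]
    have := isFiniteMeasure_withDensity_ofReal (integrable_mixtureDensity ε μ).2
    infer_instance
  have := hfin (μ := μ₀) hε₀.le (by linarith)
  have := hfin (μ := μ₁) (hε₀.trans h01).le hε₁
  have h4 : 1 / 4 ≤ (sampleLaw n (ε₁, μ₁)).real {x | T x ≤ ε₀} := by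
    have : 1 - α ≤ (sampleLaw n (ε₀, μ₀)).real {x | T x ≤ ε₀} :=
      (ENNReal.ofReal_le_iff_le_toReal (measure_ne_top _ _)).1 hcov
    linarith
  have h4' : ENNReal.ofReal (1 / 4) ≤ sampleLaw n (ε₁, μ₁) {x | T x ≤ ε₀} :=
    (ENNReal.ofReal_le_iff_le_toReal (measure_ne_top _ _)).2 h4
  have hε₁0 : 0 < ε₁ := hε₀.trans h01
  have hnn : 0 ≤ 1 - ε₀ / ε₁ := by
    rw [sub_nonneg, div_le_one hε₁0]
    exact h01.le
  calc ENNReal.ofReal ((1 - ε₀ / ε₁) / 4)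
      = ENNReal.ofReal (1 - ε₀ / ε₁) * ENNReal.ofReal (1 / 4) := by
        rw [← ENNReal.ofReal_mul hnn]
        ring_nf
    _ ≤ ENNReal.ofReal (1 - ε₀ / ε₁) * sampleLaw n (ε₁, μ₁) {x | T x ≤ ε₀} := by gcongr
    _ = ∫⁻ _ in {x | T x ≤ ε₀}, ENNReal.ofReal (1 - ε₀ / ε₁) ∂(sampleLaw n (ε₁, μ₁)) := by
        rw [setLIntegral_const]
    _ ≤ ∫⁻ x in {x | T x ≤ ε₀}, ENNReal.ofReal (max (1 - T x / ε₁) 0)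
          ∂(sampleLaw n (ε₁, μ₁)) := by
        refine setLIntegral_mono' hA fun x hx => ENNReal.ofReal_le_ofReal (le_max_of_le_left ?_)
        have : T x / ε₁ ≤ ε₀ / ε₁ := div_le_div_of_nonneg_right hx hε₁0.le
        linarith
    _ ≤ underestimationRisk T (ε₁, μ₁) := setLIntegral_le_lintegral _ _

/-! ### Signal part of the chi-square divergence -/

theorem gaussianLR_mul (μ ν x : ℝ) :
    gaussianLR μ x * gaussianLR ν x = Real.exp (μ * ν) * gaussianLR (μ + ν) x := by
  simp only [gaussianLR, ← Real.exp_add]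
  ring_nf

theorem sq_sub_gaussianLR (ε₀ ε₁ μ₀ μ₁ x : ℝ) :
    (ε₁ * gaussianLR μ₁ x - ε₀ * gaussianLR μ₀ x) ^ 2 =
      ε₁ ^ 2 * Real.exp (μ₁ ^ 2) * gaussianLR (μ₁ + μ₁) x
        - 2 * ε₀ * ε₁ * Real.exp (μ₁ * μ₀) * gaussianLR (μ₁ + μ₀) x
        + ε₀ ^ 2 * Real.exp (μ₀ ^ 2) * gaussianLR (μ₀ + μ₀) x := by
  have h1 := gaussianLR_mul μ₁ μ₁ x
  have h2 := gaussianLR_mul μ₁ μ₀ x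
  have h3 := gaussianLR_mul μ₀ μ₀ x
  rw [sq μ₁, sq μ₀]
  linear_combination ε₁ ^ 2 * h1 - 2 * ε₀ * ε₁ * h2 + ε₀ ^ 2 * h3

theorem integrable_sq_sub_gaussianLR (ε₀ ε₁ μ₀ μ₁ : ℝ) :
    Integrable (fun x => (ε₁ * gaussianLR μ₁ x - ε₀ * gaussianLR μ₀ x) ^ 2)
      (gaussianReal 0 1) := by
  simp_rw [sq_sub_gaussianLR]
  exact (((integrable_gaussianLR _).const_mul _).sub ((integrable_gaussianLR _).const_mul _)).add
    ((integrable_gaussianLR _).const_mul _)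

theorem integral_sq_sub_gaussianLR (ε₀ ε₁ μ₀ μ₁ : ℝ) :
    ∫ x, (ε₁ * gaussianLR μ₁ x - ε₀ * gaussianLR μ₀ x) ^ 2 ∂(gaussianReal 0 1) =
      ε₁ ^ 2 * Real.exp (μ₁ ^ 2) - 2 * ε₀ * ε₁ * Real.exp (μ₁ * μ₀)
        + ε₀ ^ 2 * Real.exp (μ₀ ^ 2) := by
  simp_rw [sq_sub_gaussianLR]
  have i1 := (integrable_gaussianLR (μ₁ + μ₁)).const_mul (ε₁ ^ 2 * Real.exp (μ₁ ^ 2))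
  have i2 := (integrable_gaussianLR (μ₁ + μ₀)).const_mul (2 * ε₀ * ε₁ * Real.exp (μ₁ * μ₀))
  have i3 := (integrable_gaussianLR (μ₀ + μ₀)).const_mul (ε₀ ^ 2 * Real.exp (μ₀ ^ 2))
  have h := integral_add (i1.sub i2) i3
  simp only [Pi.sub_apply] at h
  rw [h, integral_sub i1 i2]
  simp only [integral_const_mul, integral_gaussianLR, mul_one]

theorem integrable_signal {ε₀ w : ℝ} (hε₀ : 0 ≤ ε₀) (hw : 0 < w)
    (hw1 : w ≤ 1 - ε₀) (ε₁ μ₀ μ₁ : ℝ) :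
    Integrable (fun x => (ε₁ * gaussianLR μ₁ x - ε₀ * gaussianLR μ₀ x) ^ 2 /
      mixtureDensity ε₀ μ₀ x) (gaussianReal 0 1) := by
  refine ((integrable_sq_sub_gaussianLR ε₀ ε₁ μ₀ μ₁).div_const w).mono' ?_
    (Filter.Eventually.of_forall fun x => ?_)
  · unfold mixtureDensity
    exact Measurable.aestronglyMeasurable (by fun_prop)
  · have h := le_mixtureDensity hε₀ hw1 μ₀ x
    have hp := hw.trans_le h
    rw [Real.norm_of_nonneg (by positivity)]
    gcongr

/-- Matching the two signals at `x = 2 m`, where `φ · (dN(m, 1) / dN(0, 1))²` peaks. -/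
theorem integral_signal_le_of_match_two_mul {ε₀ w : ℝ} (hε₀ : 0 ≤ ε₀) (hw : 0 < w)
    (hw1 : w ≤ 1 - ε₀) {m h : ℝ} (h2 : 2 * h ^ 2 ≤ 1) :
    ∫ x, (ε₀ * Real.exp (h * (2 * m - m + h / 2)) * gaussianLR (m - h) x -
      ε₀ * gaussianLR m x) ^ 2 / mixtureDensity ε₀ m x ∂(gaussianReal 0 1) ≤
      ε₀ ^ 2 * Real.exp (m ^ 2) * (4 * h ^ 2) / w := by
  set ε₁ := ε₀ * Real.exp (h * (2 * m - m + h / 2)) with hε₁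
  calc _ ≤ ∫ x, (ε₁ * gaussianLR (m - h) x - ε₀ * gaussianLR m x) ^ 2 / w
          ∂(gaussianReal 0 1) := by
        refine integral_mono (integrable_signal hε₀ hw hw1 _ _ _)
          ((integrable_sq_sub_gaussianLR _ _ _ _).div_const w) fun x => ?_
        have h := le_mixtureDensity hε₀ hw1 m x
        simp only
        gcongr
    _ = ε₀ ^ 2 * (Real.exp (m ^ 2 + 2 * h ^ 2) - 2 * Real.exp (m ^ 2 + h ^ 2 / 2)
          + Real.exp (m ^ 2)) / w := by
        rw [integral_div, integral_sq_sub_gaussianLR, hε₁]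
        have e1 : Real.exp (h * (2 * m - m + h / 2)) ^ 2 * Real.exp ((m - h) ^ 2) =
            Real.exp (m ^ 2 + 2 * h ^ 2) := by
          rw [sq (Real.exp _), ← Real.exp_add, ← Real.exp_add]
          ring_nf
        have e2 : Real.exp (h * (2 * m - m + h / 2)) * Real.exp ((m - h) * m) =
            Real.exp (m ^ 2 + h ^ 2 / 2) := by
          rw [← Real.exp_add]
          ring_nf
        rw [← e1, ← e2]
        ring
    _ ≤ _ := by
        have e3 : Real.exp (2 * h ^ 2) ≤ 1 + 4 * h ^ 2 := by
          have h0 : 0 ≤ 2 * h ^ 2 := by positivity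
          have := (abs_le.1 (Real.abs_exp_sub_one_sub_id_le (x := 2 * h ^ 2)
            (by rwa [abs_of_nonneg h0]))).2
          nlinarith
        have e4 : 1 ≤ Real.exp (h ^ 2 / 2) := Real.one_le_exp (by positivity)
        rw [mul_assoc, Real.exp_add, Real.exp_add]
        have e5 := Real.exp_pos (m ^ 2)
        gcongr
        nlinarith

/-- The two signals differ only in weight; the denominator is bounded below by the signal. -/
theorem integral_signal_le_of_same_mean {ε₀ w : ℝ} (hε₀ : 0 < ε₀) (hw : 0 < w)
    (hw1 : w ≤ 1 - ε₀) (m δ : ℝ) :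
    ∫ x, (ε₀ * (1 + δ) * gaussianLR m x - ε₀ * gaussianLR m x) ^ 2 / mixtureDensity ε₀ m x
      ∂(gaussianReal 0 1) ≤ ε₀ * δ ^ 2 := by
  calc _ ≤ ∫ x, ε₀ * δ ^ 2 * gaussianLR m x ∂(gaussianReal 0 1) := by
        refine integral_mono (integrable_signal hε₀.le hw hw1 _ _ _)
          ((integrable_gaussianLR m).const_mul _) fun x => ?_
        have hL := gaussianLR_pos m x
        have hle : ε₀ * gaussianLR m x ≤ mixtureDensity ε₀ m x := by
          unfold mixtureDensity
          linarith
        simp only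
        rw [div_le_iff₀ (hw.trans_le (le_mixtureDensity hε₀.le hw1 m x))]
        calc _ = ε₀ * δ ^ 2 * gaussianLR m x * (ε₀ * gaussianLR m x) := by ring
          _ ≤ _ := by gcongr
    _ = ε₀ * δ ^ 2 := by rw [integral_const_mul, integral_gaussianLR, mul_one]

theorem integral_sq_mul_exp_neg_abs {a : ℝ} (ha : 0 < a) :
    ∫ s : ℝ, s ^ 2 * Real.exp (-(a * |s|)) = 4 / a ^ 3 := by
  have h := integral_comp_abs (f := fun t : ℝ => t ^ 2 * Real.exp (-(a * t)))
  simp only [sq_abs] at h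
  have h2 := Real.integral_rpow_mul_exp_neg_mul_Ioi (a := 3) (r := a) (by norm_num) ha
  have h3 : ((3 : ℝ) - 1) = ((2 : ℕ) : ℝ) := by norm_num
  simp only [h3, Real.rpow_natCast] at h2
  rw [h, h2]
  have h4 : Real.Gamma 3 = 2 := by
    rw [show (3 : ℝ) = (2 : ℕ) + 1 by norm_num, Real.Gamma_nat_eq_factorial]
    norm_num
  have h5 : (1 / a) ^ (3 : ℝ) = (1 / a) ^ 3 := by
    rw [← Real.rpow_natCast]
    norm_num
  rw [h4, h5]
  field_simp
  norm_num

theorem integrable_sq_mul_exp_neg_abs {a : ℝ} (ha : 0 < a) :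
    Integrable fun s : ℝ => s ^ 2 * Real.exp (-(a * |s|)) := by
  refine Integrable.of_integral_ne_zero ?_
  rw [integral_sq_mul_exp_neg_abs ha]
  positivity

theorem exp_sub_one_sq_le_of_nonneg {u : ℝ} (hu : 0 ≤ u) :
    (Real.exp u - 1) ^ 2 ≤ u ^ 2 * Real.exp (2 * u) := by
  have h1 : 0 ≤ Real.exp u - 1 := by linarith [Real.one_le_exp hu]
  have h2 : Real.exp u - 1 ≤ u * Real.exp u := by
    have h := Real.add_one_le_exp (-u)
    have h3 : Real.exp u * Real.exp (-u) = 1 := by rw [← Real.exp_add]; simp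
    nlinarith [Real.exp_pos u]
  calc _ ≤ (u * Real.exp u) ^ 2 := by gcongr
    _ = _ := by rw [mul_pow, sq (Real.exp u), ← Real.exp_add]; ring_nf

theorem exp_neg_sub_one_sq_le_of_nonneg {u : ℝ} (hu : 0 ≤ u) :
    (Real.exp (-u) - 1) ^ 2 ≤ u ^ 2 := by
  have h1 : Real.exp (-u) ≤ 1 := Real.exp_le_one_iff.2 (by linarith)
  have h := Real.add_one_le_exp (-u)
  nlinarith

theorem exp_mul_gaussianLR_sub (m h y x : ℝ) :
    Real.exp (h * (y - m + h / 2)) * gaussianLR (m - h) x =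
      gaussianLR m x * Real.exp (-(h * (x - y))) := by
  simp only [gaussianLR, ← Real.exp_add]
  ring_nf

/-- Matching the two signals at a point `y` strictly between `m` and `2 m`. To the left of `y` the
integrand is controlled by `φ · (signal)²`, which increases at the rate `2 m - y`; to the right it
is controlled by `φ · signal`, which decreases at the rate `y - m`. -/
theorem integral_signal_le_of_match {ε₀ w m h y a κ : ℝ} (hε₀ : 0 < ε₀) (hw : 0 < w)
    (hw1 : w ≤ 1 - ε₀) (hh : 0 ≤ h) (ha : 0 < a) (hay : a ≤ y - m) (ham : a ≤ 2 * m - y - 2 * h)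
    (hκ : ε₀ * gaussianLR m y = κ) :
    ∫ x, (ε₀ * Real.exp (h * (y - m + h / 2)) * gaussianLR (m - h) x -
      ε₀ * gaussianLR m x) ^ 2 / mixtureDensity ε₀ m x ∂(gaussianReal 0 1) ≤
      Real.exp (-(y ^ 2 / 2)) * (κ + κ ^ 2 / w) * h ^ 2 * (4 / a ^ 3) := by
  have hκ0 : 0 < κ := hκ ▸ mul_pos hε₀ (gaussianLR_pos _ _)
  have hS : ∀ x, ε₀ * gaussianLR m x = κ * Real.exp (m * (x - y)) := fun x => by
    rw [← hκ, mul_assoc, gaussianLR, gaussianLR, ← Real.exp_add]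
    ring_nf
  rw [integral_gaussianReal_eq_integral_smul one_ne_zero]
  set K := Real.exp (-(y ^ 2 / 2)) * (κ + κ ^ 2 / w) * h ^ 2 with hK
  have hint : Integrable fun x : ℝ => K * ((x - y) ^ 2 * Real.exp (-(a * |x - y|))) :=
    ((integrable_sq_mul_exp_neg_abs ha).comp_sub_right y).const_mul K
  have hI : ∫ x : ℝ, K * ((x - y) ^ 2 * Real.exp (-(a * |x - y|))) = K * (4 / a ^ 3) := by
    rw [integral_const_mul,
      integral_sub_right_eq_self (fun s : ℝ => s ^ 2 * Real.exp (-(a * |s|))) y,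
      integral_sq_mul_exp_neg_abs ha]
  rw [← hI]
  have hmw := le_mixtureDensity hε₀.le hw1 m
  refine integral_mono_of_nonneg (Filter.Eventually.of_forall fun x => ?_) hint
    (Filter.Eventually.of_forall fun x => ?_)
  · exact smul_nonneg (gaussianPDFReal_nonneg _ _ _)
      (div_nonneg (sq_nonneg _) (hw.le.trans (hmw x)))
  set s := x - y with hs
  have hφ : gaussianPDFReal 0 1 x ≤ Real.exp (-(y ^ 2 / 2)) * Real.exp (-(y * s)) := by
    rw [gaussianPDFReal, ← Real.exp_add]
    have h1 : (√(2 * Real.pi * ((1 : NNReal) : ℝ)))⁻¹ ≤ 1 := by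
      apply inv_le_one_of_one_le₀
      rw [Real.one_le_sqrt]
      push_cast
      linarith [Real.pi_gt_three]
    calc _ ≤ 1 * Real.exp (-(x - 0) ^ 2 / (2 * ((1 : NNReal) : ℝ))) := by gcongr
      _ ≤ _ := by
        rw [one_mul, Real.exp_le_exp, hs]
        push_cast
        nlinarith [sq_nonneg (x - y)]
  have hA : ε₀ * Real.exp (h * (y - m + h / 2)) * gaussianLR (m - h) x - ε₀ * gaussianLR m x =
      κ * Real.exp (m * s) * (Real.exp (-(h * s)) - 1) := by
    rw [mul_assoc, exp_mul_gaussianLR_sub, ← mul_assoc, hS]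
    ring
  simp only [smul_eq_mul]
  rw [hA]
  have hd := hmw x
  have hdS : κ * Real.exp (m * s) ≤ mixtureDensity ε₀ m x := by
    rw [← hS]
    unfold mixtureDensity
    linarith
  have hD : 0 < mixtureDensity ε₀ m x := hw.trans_le hd
  have hE := Real.exp_pos (m * s)
  rcases le_total 0 s with h0 | h0
  · have h1 := exp_neg_sub_one_sq_le_of_nonneg (mul_nonneg hh h0)
    calc _ ≤ (Real.exp (-(y ^ 2 / 2)) * Real.exp (-(y * s))) *
          ((κ * Real.exp (m * s)) ^ 2 * (h * s) ^ 2 / (κ * Real.exp (m * s))) := by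
          rw [mul_pow]
          gcongr
      _ = Real.exp (-(y ^ 2 / 2)) * κ * h ^ 2 * (s ^ 2 * Real.exp (-((y - m) * s))) := by
          have : Real.exp (-((y - m) * s)) = Real.exp (-(y * s)) * Real.exp (m * s) := by
            rw [← Real.exp_add]
            ring_nf
          rw [this]
          field_simp
      _ ≤ K * (s ^ 2 * Real.exp (-(a * |s|))) := by
          rw [hK, abs_of_nonneg h0]
          have : κ ≤ κ + κ ^ 2 / w := le_add_of_nonneg_right (by positivity)
          gcongr
  · have h1 := exp_sub_one_sq_le_of_nonneg (u := -(h * s)) (by nlinarith)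
    calc _ ≤ (Real.exp (-(y ^ 2 / 2)) * Real.exp (-(y * s))) *
          ((κ * Real.exp (m * s)) ^ 2 * ((-(h * s)) ^ 2 * Real.exp (2 * -(h * s))) / w) := by
          rw [mul_pow]
          gcongr
      _ = Real.exp (-(y ^ 2 / 2)) * (κ ^ 2 / w) * h ^ 2 *
            (s ^ 2 * Real.exp ((2 * m - y - 2 * h) * s)) := by
          have : Real.exp ((2 * m - y - 2 * h) * s) =
              Real.exp (-(y * s)) * Real.exp (m * s) ^ 2 * Real.exp (2 * -(h * s)) := by
            rw [sq, ← Real.exp_add, ← Real.exp_add, ← Real.exp_add]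
            ring_nf
          rw [this]
          ring
      _ ≤ K * (s ^ 2 * Real.exp (-(a * |s|))) := by
          rw [hK, abs_of_nonpos h0]
          have : κ ^ 2 / w ≤ κ + κ ^ 2 / w := le_add_of_nonneg_left hκ0.le
          have : (2 * m - y - 2 * h) * s ≤ -(a * -s) := by nlinarith
          gcongr

/-! ### Rates -/

theorem exists_log_rpow_mul_rpow_neg_le (p : ℝ) {s : ℝ} (hs : 0 < s) :
    ∃ B : ℝ, 0 < B ∧ ∀ n : ℕ, 2 ≤ n → Real.log n ^ p * (n : ℝ) ^ (-s) ≤ B := by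
  have h := ((isLittleO_log_rpow_rpow_atTop p hs).comp_tendsto
    tendsto_natCast_atTop_atTop).bound one_pos
  obtain ⟨N, hN⟩ := Filter.eventually_atTop.1 h
  refine ⟨1 + ∑ n ∈ Finset.range N, |Real.log n ^ p * (n : ℝ) ^ (-s)|,
    add_pos_of_pos_of_nonneg one_pos (Finset.sum_nonneg fun _ _ => abs_nonneg _), fun n hn => ?_⟩
  have hn0 : (0 : ℝ) < n := by positivity
  rcases lt_or_ge n N with hlt | hge
  · have := Finset.single_le_sum (f := fun n : ℕ => |Real.log n ^ p * (n : ℝ) ^ (-s)|)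
      (fun _ _ => abs_nonneg _) (Finset.mem_range.2 hlt)
    linarith [le_abs_self (Real.log n ^ p * (n : ℝ) ^ (-s))]
  · have h1 := hN n hge
    simp only [Function.comp_apply, one_mul] at h1
    rw [Real.norm_of_nonneg (Real.rpow_nonneg hn0.le s)] at h1
    have h2 : Real.log n ^ p * (n : ℝ) ^ (-s) ≤ 1 := by
      rw [Real.rpow_neg hn0.le, ← div_eq_mul_inv, div_le_one (Real.rpow_pos_of_pos hn0 s)]
      exact (le_abs_self _).trans h1
    have := Finset.sum_nonneg fun n (_ : n ∈ Finset.range N) =>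
      abs_nonneg (Real.log n ^ p * (n : ℝ) ^ (-s))
    linarith

theorem half_le_log_natCast {n : ℕ} (hn : 2 ≤ n) : 1 / 2 ≤ Real.log n := by
  have h1 : Real.log 2 ≤ Real.log n :=
    Real.log_le_log (by norm_num) (by exact_mod_cast hn)
  linarith [Real.log_two_gt_d9]

/-- A shift of the mean of the order `(log n)^p n^{-s}`, with a small constant, stays in the window
of width `a / log n` and induces a small relative change of the weight. -/
theorem exists_shift_small {k a d s : ℝ} (hk : 0 < k) (ha : 0 < a) (hd : 0 < d) (hs : 0 < s)
    (p : ℝ) :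
    ∃ c₀ : ℝ, 0 < c₀ ∧ ∀ c, 0 < c → c ≤ c₀ → ∀ n : ℕ, 2 ≤ n → ∀ h,
      h = c * (Real.log n ^ p * (n : ℝ) ^ (-s)) →
      h ≤ a ∧ h * Real.log n ≤ a ∧ Real.exp (h * (k * √(Real.log n) + h / 2)) - 1 ≤ d := by
  obtain ⟨B, hB, hBn⟩ := exists_log_rpow_mul_rpow_neg_le (p + 1) hs
  refine ⟨min 1 (min (a / (2 * B)) (min 1 (d / 2) / (2 * B * k + 2 * B ^ 2))), by positivity,
    fun c hc hcc n hn h hh => ?_⟩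
  simp only [le_min_iff] at hcc
  obtain ⟨hc1, hc2, hc3⟩ := hcc
  rw [le_div_iff₀ (by positivity)] at hc2
  rw [le_div_iff₀ (by positivity), le_min_iff] at hc3
  have hl := half_le_log_natCast hn
  have hn0 : (0 : ℝ) < n := by positivity
  have hhl : h * Real.log n ≤ c * B := by
    have h1 := hBn n hn
    rw [Real.rpow_add (by linarith), Real.rpow_one] at h1
    rw [hh]
    calc _ = c * (Real.log n ^ p * Real.log n * (n : ℝ) ^ (-s)) := by ring
      _ ≤ _ := by gcongr
  have hh0 : 0 ≤ h := hh ▸ by positivity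
  have hh1 : h ≤ 2 * (c * B) := by nlinarith
  have hsq : √(Real.log n) ≤ 2 * Real.log n := by
    rw [Real.sqrt_le_iff]
    constructor
    · linarith
    · nlinarith
  have hu : h * (k * √(Real.log n) + h / 2) ≤ c * (2 * B * k + 2 * B ^ 2) := by
    have h1 : h * √(Real.log n) ≤ 2 * (c * B) := by nlinarith
    have h2 : h * h ≤ 2 * (c * B) * (2 * (c * B)) := by gcongr
    have h3 : c * c ≤ c := by nlinarith
    have h4 : c * c * B ^ 2 ≤ c * B ^ 2 := by gcongr
    nlinarith
  have hu0 : 0 ≤ h * (k * √(Real.log n) + h / 2) := by positivity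
  refine ⟨by linarith, by nlinarith, ?_⟩
  set u := h * (k * √(Real.log n) + h / 2)
  have hu1 : u ≤ 1 := by linarith [hc3.1]
  have := (abs_le.1 (Real.abs_exp_sub_one_sub_id_le (x := u) (by rwa [abs_of_nonneg hu0]))).2
  nlinarith [hc3.2]

/-! ### The detectable region -/

theorem sub_half_lt_of_detectionBoundary_lt {r β : ℝ} (hβ1 : β < 1)
    (hdet : detectionBoundary β < r) : β - 1 / 2 < r := by
  unfold detectionBoundary at hdet
  split_ifs at hdet with h
  · exact hdet
  · nlinarith [sq_nonneg (2 * √(1 - β) - 1), Real.sq_sqrt (sub_nonneg.2 hβ1.le)]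

theorem add_sq_lt_of_detectionBoundary_lt {r β : ℝ} (hr0 : 0 < r) (hr1 : r < 1) (hβ0 : 0 < β)
    (hβ1 : β < 1) (h3 : β < 3 * r) (hdet : detectionBoundary β < r) :
    (β + r) ^ 2 < 4 * r := by
  set t := √(1 - β) with ht
  have ht2 : t ^ 2 = 1 - β := Real.sq_sqrt (by linarith)
  have ht0 : 0 < t := Real.sqrt_pos.2 (by linarith)
  have ht1 : t < 1 := by nlinarith
  -- for `β ≤ 3 / 4`, where the boundary is lower, this follows from `β < 3 r`
  have hr : (1 - t) ^ 2 < r := by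
    unfold detectionBoundary at hdet
    split_ifs at hdet with h
    · have : 1 / 2 ≤ t := by nlinarith
      nlinarith
    · exact hdet
  have hv0 := Real.sqrt_nonneg r
  have hv2 := Real.sq_sqrt hr0.le
  set v := √r
  have hv1 : v < 1 := by nlinarith
  have hvt : 1 - t < v := by nlinarith
  have : β + r < 2 * v := by nlinarith
  nlinarith

/-! ### The lower bound in the three regimes -/

theorem one_sub_div_le {b₁ b₂ ν : ℝ} (hb₁ : 0 ≤ b₁) (hb₂ : 0 < b₂) (h : b₂ * ν ≤ 1) :
    1 - b₁ / b₂ ≤ 1 - b₁ * ν := by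
  have : b₁ * ν ≤ b₁ / b₂ := by
    rw [le_div_iff₀ hb₂]
    nlinarith
  linarith

theorem exists_pos_le_le_mul_le {x y z : ℝ} (hx : 0 < x) (hy : 0 < y) (hz : 0 < z) :
    ∃ c : ℝ, 0 < c ∧ c ≤ 1 ∧ c ≤ x ∧ c * z ≤ y :=
  ⟨min (min 1 x) (y / z), by positivity, (min_le_left _ _).trans (min_le_left _ _),
    (min_le_left _ _).trans (min_le_right _ _), (le_div_iff₀ hz).1 (min_le_right _ _)⟩

/-- The problem of bounding the risk below by a multiple of `δ`, reduced to a bound on the signal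
part of the chi-square divergence between the parameters `(b₁ n^{-β}, √(2 r log n))` and
`((1 + δ) b₁ n^{-β}, μ₁)`. The change of weight alone is harmless because `n (n^{-β})² ≤ 1`. -/
theorem exists_le_iSup_underestimationRisk {r β a₁ a₂ b₁ b₂ α : ℝ} (hβ0 : 1 / 2 < β)
    (ha₁ : 0 < a₁) (ha₂ : 0 < a₂) (hb₁ : 0 < b₁) (hb : b₁ < b₂) (hα1 : α < 1 / 2) :
    ∃ d : ℝ, 0 < d ∧ ∀ n : ℕ, 2 ≤ n → b₂ * (n : ℝ) ^ (-β) ≤ 1 → ∀ δ, 0 < δ → δ ≤ d →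
      ∀ h, 0 ≤ h → h * Real.log n ≤ a₁ →
      (n : ℝ) * ∫ x, (b₁ * (n : ℝ) ^ (-β) * (1 + δ) * gaussianLR (√(2 * r * Real.log n) - h) x -
        b₁ * (n : ℝ) ^ (-β) * gaussianLR √(2 * r * Real.log n) x) ^ 2 /
        mixtureDensity (b₁ * (n : ℝ) ^ (-β)) √(2 * r * Real.log n) x ∂(gaussianReal 0 1)
        ≤ 1 / 128 →
      ∀ T : (Fin n → ℝ) → ℝ, IsLowerConfidenceLimit (paramSet r β a₁ a₂ b₁ b₂ n) α T →
        ENNReal.ofReal (b₁ / (4 * b₂) * δ) ≤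
          ⨆ θ ∈ paramSet r β a₁ a₂ b₁ b₂ n, underestimationRisk T θ := by
  have hb₂ : 0 < b₂ := hb₁.trans hb
  set w := 1 - b₁ / b₂ with hw
  have hw0 : 0 < w := sub_pos.2 ((div_lt_one hb₂).2 hb)
  refine ⟨min 1 (min ((b₂ - b₁) / b₁) (w / (128 * b₁ ^ 2))), ?_,
    fun n hn hbn δ hδ hδd h hh hha hM T hT => ?_⟩
  · have : 0 < b₂ - b₁ := by linarith
    positivity
  simp only [le_min_iff] at hδd
  obtain ⟨hd1, hd2, hd3⟩ := hδd
  rw [le_div_iff₀ hb₁] at hd2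
  rw [le_div_iff₀ (by positivity)] at hd3
  have hn0 : (0 : ℝ) < n := by positivity
  have hn1 : (1 : ℝ) ≤ n := by exact_mod_cast (by omega : 1 ≤ n)
  have hl := half_le_log_natCast hn
  set ν := (n : ℝ) ^ (-β) with hν
  have hν0 : 0 < ν := Real.rpow_pos_of_pos hn0 _
  have hnν : n * ν ^ 2 ≤ 1 := by
    have : (n : ℝ) * ν ^ 2 = (n : ℝ) ^ (1 + -β * 2) := by
      rw [Real.rpow_add hn0, Real.rpow_one, Real.rpow_mul hn0.le, Real.rpow_two]
    rw [this]
    exact Real.rpow_le_one_of_one_le_of_nonpos hn1 (by linarith)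
  have hε₀ : 0 < b₁ * ν := by positivity
  have hw1 : w ≤ 1 - b₁ * ν := one_sub_div_le hb₁.le hb₂ hbn
  have hmem0 : (b₁ * ν, √(2 * r * Real.log n)) ∈ paramSet r β a₁ a₂ b₁ b₂ n := by
    have h1 : 0 ≤ a₁ / Real.log n := by positivity
    have h2 : 0 ≤ a₂ / Real.log n := by positivity
    refine ⟨le_rfl, ?_, ?_, ?_⟩ <;> simp only
    · rw [← hν]
      gcongr
    · linarith
    · linarith
  have hup : b₁ * ν * (1 + δ) ≤ b₂ * ν := by nlinarith
  have hmem1 : (b₁ * ν * (1 + δ), √(2 * r * Real.log n) - h) ∈ paramSet r β a₁ a₂ b₁ b₂ n := by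
    have h1 : h ≤ a₁ / Real.log n := by rwa [le_div_iff₀ (by linarith)]
    have h2 : 0 ≤ a₂ / Real.log n := by positivity
    refine ⟨?_, hup, ?_, ?_⟩ <;> simp only
    · rw [← hν]
      nlinarith
    · linarith
    · linarith
  obtain ⟨hi, hle⟩ := chiSq_mixtureDensity_le hε₀.le hw0 hw1
    (integrable_signal hε₀.le hw0 hw1 _ _ _) le_rfl
  have hlt : b₁ * ν < b₁ * ν * (1 + δ) := by nlinarith
  refine le_trans (le_trans (ENNReal.ofReal_le_ofReal ?_)
    (le_underestimationRisk hα1 hT hε₀ hlt (hup.trans hbn) hmem0 hi ?_))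
    (le_iSup₂_of_le _ hmem1 le_rfl)
  · have h1 : b₁ * ν / (b₁ * ν * (1 + δ)) = 1 / (1 + δ) := by
      field_simp
    rw [h1]
    have h2 : (1 - 1 / (1 + δ)) / 4 = δ / (4 * (1 + δ)) := by
      field_simp
      ring
    rw [h2, div_mul_eq_mul_div, div_le_div_iff₀ (by positivity) (by positivity)]
    nlinarith
  · have h3 : n * (2 * (b₁ * ν * (1 + δ) - b₁ * ν) ^ 2 / w) ≤ 1 / 64 := by
      calc _ = 2 * b₁ ^ 2 * δ ^ 2 * (n * ν ^ 2) / w := by ring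
        _ ≤ 2 * b₁ ^ 2 * δ ^ 2 * 1 / w := by gcongr
        _ ≤ 1 / 64 := by
          rw [div_le_iff₀ hw0]
          have : b₁ ^ 2 * δ ^ 2 ≤ b₁ ^ 2 * δ := by
            gcongr
            exact pow_le_of_le_one hδ.le hd1 two_ne_zero
          linarith
    have h4 := mul_le_mul_of_nonneg_left hle hn0.le
    linarith

/-- In the regime `β ≥ 3 r` the signals are matched at `2 μ`. -/
theorem exists_rate_of_three_mul_le {r β a₁ a₂ b₁ b₂ α : ℝ} (hr0 : 0 < r) (hβ0 : 1 / 2 < β)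
    (hdet : β - 1 / 2 < r)
    (ha₁ : 0 < a₁) (ha₂ : 0 < a₂) (hb₁ : 0 < b₁) (hb : b₁ < b₂) (hα1 : α < 1 / 2) :
    ∃ C : ℝ, 0 < C ∧ ∀ n : ℕ, 2 ≤ n → b₂ * (n : ℝ) ^ (-β) ≤ 1 →
      ∀ T : (Fin n → ℝ) → ℝ, IsLowerConfidenceLimit (paramSet r β a₁ a₂ b₁ b₂ n) α T →
        ENNReal.ofReal (C * (Real.log n ^ (1 / 2 : ℝ) * (n : ℝ) ^ (-(1 / 2) - r + β))) ≤
          ⨆ θ ∈ paramSet r β a₁ a₂ b₁ b₂ n, underestimationRisk T θ := by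
  have hb₂ : 0 < b₂ := hb₁.trans hb
  have hw0 : 0 < 1 - b₁ / b₂ := sub_pos.2 ((div_lt_one hb₂).2 hb)
  set w := 1 - b₁ / b₂ with hw
  obtain ⟨d, hd, hmain⟩ := exists_le_iSup_underestimationRisk (r := r) hβ0 ha₁ ha₂ hb₁ hb hα1
  have hk : 0 < √(2 * r) := Real.sqrt_pos.2 (by linarith)
  obtain ⟨c₀, hc₀, hc⟩ := exists_shift_small (s := 1 / 2 + r - β) hk
    (lt_min ha₁ (by norm_num : (0 : ℝ) < 1 / 2)) hd (by linarith) 0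
  obtain ⟨c, hc0, hc1, hcc, hcw⟩ := exists_pos_le_le_mul_le hc₀ hw0
    (by positivity : 0 < 512 * b₁ ^ 2)
  have hc2 : c ^ 2 ≤ c := pow_le_of_le_one hc0.le hc1 two_ne_zero
  refine ⟨b₁ / (4 * b₂) * (c * √(2 * r)), by positivity, fun n hn hbn T hT => ?_⟩
  obtain ⟨h1, h2, h3⟩ := hc c hc0 hcc n hn _ rfl
  have hn0 : (0 : ℝ) < n := by positivity
  have hl := half_le_log_natCast hn
  rw [Real.rpow_zero, one_mul] at h1 h2 h3
  rw [le_min_iff] at h1 h2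
  set h := c * (n : ℝ) ^ (-(1 / 2 + r - β)) with hh
  have hh0 : 0 < h := by positivity
  set m := √(2 * r * Real.log n) with hm
  have hmeq : m = √(2 * r) * √(Real.log n) := by rw [hm, Real.sqrt_mul (by linarith)]
  have hm2 : m ^ 2 = 2 * r * Real.log n := Real.sq_sqrt (by positivity)
  have hm0 : 0 < m := Real.sqrt_pos.2 (by positivity)
  set δ := Real.exp (h * (2 * m - m + h / 2)) - 1 with hδ
  have hδd : δ ≤ d := by
    rw [← hmeq] at h3
    rwa [hδ, show 2 * m - m = m by ring]
  have hδh : h * m ≤ δ := by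
    have := Real.add_one_le_exp (h * (2 * m - m + h / 2))
    linarith [mul_pos hh0 hh0]
  set ν := (n : ℝ) ^ (-β) with hν
  have hν0 : 0 < ν := Real.rpow_pos_of_pos hn0 _
  have hw1 : w ≤ 1 - b₁ * ν := one_sub_div_le hb₁.le hb₂ hbn
  have hM := integral_signal_le_of_match_two_mul (ε₀ := b₁ * ν) (m := m) (h := h) (by positivity)
    hw0 hw1 (by linarith [pow_le_pow_left₀ hh0.le h1.2 2])
  refine (ENNReal.ofReal_le_ofReal ?_).trans (hmain n hn hbn δ
    ((mul_pos hh0 hm0).trans_le hδh) hδd h hh0.le h2.1 ?_ T hT)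
  · calc _ = b₁ / (4 * b₂) * (h * m) := by
          rw [hh, hmeq, Real.sqrt_eq_rpow (Real.log n),
            show -(1 / 2) - r + β = -(1 / 2 + r - β) by ring]
          ring
      _ ≤ _ := by gcongr
  · rw [show 1 + δ = Real.exp (h * (2 * m - m + h / 2)) by rw [hδ]; ring]
    refine (mul_le_mul_of_nonneg_left hM hn0.le).trans ?_
    have he : Real.exp (m ^ 2) = (n : ℝ) ^ (2 * r) := by
      rw [hm2, Real.rpow_def_of_pos hn0]
      ring_nf
    have hp : (n : ℝ) * ν ^ 2 * (n : ℝ) ^ (2 * r) * ((n : ℝ) ^ (-(1 / 2 + r - β))) ^ 2 = 1 := by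
      rw [hν, ← Real.rpow_mul_natCast hn0.le, ← Real.rpow_mul_natCast hn0.le]
      nth_rewrite 1 [← Real.rpow_one (n : ℝ)]
      rw [← Real.rpow_add hn0, ← Real.rpow_add hn0, ← Real.rpow_add hn0]
      convert Real.rpow_zero (n : ℝ) using 2
      push_cast
      ring
    calc _ = 4 * b₁ ^ 2 * c ^ 2 *
          ((n : ℝ) * ν ^ 2 * (n : ℝ) ^ (2 * r) * ((n : ℝ) ^ (-(1 / 2 + r - β))) ^ 2) / w := by
          rw [he, hh]
          ring
      _ ≤ 1 / 128 := by
          rw [hp, mul_one, div_le_iff₀ hw0]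
          have : b₁ ^ 2 * c ^ 2 ≤ b₁ ^ 2 * c := by
            gcongr
          linarith

/-- In the regime `r < β < 3 r` the signals are matched at `y = (β + r) √(log n) / √(2 r)`, where
the two components of the mixture are of the same order: the likelihood ratio there is `n^β`. -/
theorem exists_rate_of_lt_of_lt_three_mul {r β a₁ a₂ b₁ b₂ α : ℝ} (hr0 : 0 < r)
    (hβ0 : 1 / 2 < β) (hrβ : r < β) (hβr : β < 3 * r) (hdet : (β + r) ^ 2 < 4 * r)
    (ha₁ : 0 < a₁) (ha₂ : 0 < a₂) (hb₁ : 0 < b₁) (hb : b₁ < b₂) (hα1 : α < 1 / 2) :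
    ∃ C : ℝ, 0 < C ∧ ∀ n : ℕ, 2 ≤ n → b₂ * (n : ℝ) ^ (-β) ≤ 1 →
      ∀ T : (Fin n → ℝ) → ℝ, IsLowerConfidenceLimit (paramSet r β a₁ a₂ b₁ b₂ n) α T →
        ENNReal.ofReal
          (C * (Real.log n ^ (5 / 4 : ℝ) * (n : ℝ) ^ (-(1 / 2) + (β + r) ^ 2 / (8 * r)))) ≤
          ⨆ θ ∈ paramSet r β a₁ a₂ b₁ b₂ n, underestimationRisk T θ := by
  have hb₂ : 0 < b₂ := hb₁.trans hb
  have hw0 : 0 < 1 - b₁ / b₂ := sub_pos.2 ((div_lt_one hb₂).2 hb)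
  set w := 1 - b₁ / b₂ with hw
  obtain ⟨d, hd, hmain⟩ := exists_le_iSup_underestimationRisk (r := r) hβ0 ha₁ ha₂ hb₁ hb hα1
  set R := √(2 * r) with hR
  have hR0 : 0 < R := Real.sqrt_pos.2 (by linarith)
  have hR2 : R ^ 2 = 2 * r := Real.sq_sqrt (by linarith)
  -- `y - μ = k √(log n)` and `2 μ - y = k' √(log n)`
  set k := (β - r) / R with hk
  set k' := (3 * r - β) / R with hk'
  have hk0 : 0 < k := div_pos (by linarith) hR0
  have hk'0 : 0 < k' := div_pos (by linarith) hR0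
  set k₁ := min k (k' / 2) with hk₁
  have hk₁0 : 0 < k₁ := by positivity
  set s := 1 / 2 - (β + r) ^ 2 / (8 * r) with hs
  have hs0 : 0 < s := by
    rw [hs, sub_pos, div_lt_iff₀ (by positivity)]
    linarith
  obtain ⟨c₀, hc₀, hc⟩ := exists_shift_small hk0
    (lt_min ha₁ (by positivity : 0 < k' / 8)) hd hs0 (3 / 4)
  set K := (b₁ + b₁ ^ 2 / w) * (4 / k₁ ^ 3) with hK
  have hK0 : 0 < K := by positivity
  obtain ⟨c, hc0, hc1, hcc, hcK⟩ := exists_pos_le_le_mul_le hc₀ one_pos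
    (by positivity : 0 < 128 * K)
  have hc2 : c ^ 2 ≤ c := pow_le_of_le_one hc0.le hc1 two_ne_zero
  refine ⟨b₁ / (4 * b₂) * (c * k), by positivity, fun n hn hbn T hT => ?_⟩
  obtain ⟨h1, h2, h3⟩ := hc c hc0 hcc n hn _ rfl
  have hn0 : (0 : ℝ) < n := by positivity
  have hl := half_le_log_natCast hn
  have hl0 : 0 < Real.log n := by linarith
  rw [le_min_iff] at h1 h2
  set h := c * (Real.log n ^ (3 / 4 : ℝ) * (n : ℝ) ^ (-s)) with hh
  have hh0 : 0 < h := by positivity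
  set ℓ := √(Real.log n) with hℓ
  have hℓ2 : ℓ ^ 2 = Real.log n := Real.sq_sqrt hl0.le
  have hℓ0 : 0 < ℓ := Real.sqrt_pos.2 hl0
  have hℓh : 1 / 2 ≤ ℓ := Real.le_sqrt_of_sq_le (by linarith)
  set m := √(2 * r * Real.log n) with hm
  have hmeq : m = R * ℓ := by rw [hm, Real.sqrt_mul (by linarith)]
  set y := (β + r) / R * ℓ with hy
  have hym : y - m = k * ℓ := by
    rw [hy, hmeq, hk]
    field_simp
    rw [hR2]
    ring
  have hmy : 2 * m - y = k' * ℓ := by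
    rw [hy, hmeq, hk']
    field_simp
    rw [hR2]
    ring
  have hmyℓ : m * y - m ^ 2 / 2 = β * Real.log n := by
    have e : R * ℓ * ((β + r) / R * ℓ) = (β + r) * ℓ ^ 2 := by
      field_simp
    rw [hy, hmeq, e, mul_pow, hR2, hℓ2]
    ring
  have hy2 : y ^ 2 / 2 = (β + r) ^ 2 / (4 * r) * Real.log n := by
    rw [hy, mul_pow, div_pow, hR2, hℓ2]
    field_simp
    ring
  set δ := Real.exp (h * (y - m + h / 2)) - 1 with hδ
  have hδd : δ ≤ d := by
    rwa [hδ, hym]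
  have hδh : h * (k * ℓ) ≤ δ := by
    have := Real.add_one_le_exp (h * (y - m + h / 2))
    rw [← hym]
    linarith [mul_pos hh0 hh0]
  set ν := (n : ℝ) ^ (-β) with hν
  have hν0 : 0 < ν := Real.rpow_pos_of_pos hn0 _
  have hw1 : w ≤ 1 - b₁ * ν := one_sub_div_le hb₁.le hb₂ hbn
  have hκ : b₁ * ν * gaussianLR m y = b₁ := by
    rw [gaussianLR, hmyℓ, hν, mul_comm β, ← Real.rpow_def_of_pos hn0, mul_assoc,
      ← Real.rpow_add hn0]
    simp
  have hM := integral_signal_le_of_match (a := k₁ * ℓ) (by positivity) hw0 hw1 hh0.le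
    (by positivity) (by rw [hym]; gcongr; exact min_le_left _ _)
    (by
      have : k₁ ≤ k' / 2 := min_le_right _ _
      have h4 : k' * (1 / 2) ≤ k' * ℓ := by gcongr
      have h5 : k₁ * ℓ ≤ k' / 2 * ℓ := by gcongr
      rw [hmy]
      linarith [h1.2]) hκ
  refine (ENNReal.ofReal_le_ofReal ?_).trans (hmain n hn hbn δ
    ((mul_pos hh0 (mul_pos hk0 hℓ0)).trans_le hδh) hδd h hh0.le h2.1 ?_ T hT)
  · calc _ = b₁ / (4 * b₂) * (h * (k * ℓ)) := by
          rw [hh, hℓ, Real.sqrt_eq_rpow, hs,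
            show (5 / 4 : ℝ) = 3 / 4 + 1 / 2 by norm_num, Real.rpow_add hl0,
            show -(1 / 2) + (β + r) ^ 2 / (8 * r) = -(1 / 2 - (β + r) ^ 2 / (8 * r)) by ring]
          ring
      _ ≤ _ := by gcongr
  · rw [show 1 + δ = Real.exp (h * (y - m + h / 2)) by rw [hδ]; ring]
    refine (mul_le_mul_of_nonneg_left hM hn0.le).trans ?_
    have he : Real.exp (-(y ^ 2 / 2)) = (n : ℝ) ^ (-((β + r) ^ 2 / (4 * r))) := by
      rw [hy2, Real.rpow_def_of_pos hn0]
      ring_nf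
    have hp : (n : ℝ) * (n : ℝ) ^ (-((β + r) ^ 2 / (4 * r))) * ((n : ℝ) ^ (-s)) ^ 2 = 1 := by
      rw [← Real.rpow_mul_natCast hn0.le]
      nth_rewrite 1 [← Real.rpow_one (n : ℝ)]
      rw [← Real.rpow_add hn0, ← Real.rpow_add hn0]
      convert Real.rpow_zero (n : ℝ) using 2
      rw [hs]
      push_cast
      field_simp
      ring
    have hlog : (Real.log n ^ (3 / 4 : ℝ)) ^ 2 = ℓ ^ 3 := by
      rw [hℓ, Real.sqrt_eq_rpow, ← Real.rpow_mul_natCast hl0.le, ← Real.rpow_mul_natCast hl0.le]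
      norm_num
    calc _ = K * c ^ 2 * ((n : ℝ) * (n : ℝ) ^ (-((β + r) ^ 2 / (4 * r))) *
          ((n : ℝ) ^ (-s)) ^ 2) * ((Real.log n ^ (3 / 4 : ℝ)) ^ 2 / ℓ ^ 3) := by
          rw [he, hh, hK]
          field_simp
      _ ≤ 1 / 128 := by
          rw [hp, hlog, div_self (by positivity), mul_one, mul_one]
          have : K * c ^ 2 ≤ K * c := by
            gcongr
          linarith

/-- In the regime `β ≤ r` the two parameters share the same mean. -/
theorem exists_rate_of_le {r β a₁ a₂ b₁ b₂ α : ℝ} (hβ0 : 1 / 2 < β) (hβ1 : β < 1)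
    (ha₁ : 0 < a₁) (ha₂ : 0 < a₂) (hb₁ : 0 < b₁) (hb : b₁ < b₂) (hα1 : α < 1 / 2) :
    ∃ C : ℝ, 0 < C ∧ ∀ n : ℕ, 2 ≤ n → b₂ * (n : ℝ) ^ (-β) ≤ 1 →
      ∀ T : (Fin n → ℝ) → ℝ, IsLowerConfidenceLimit (paramSet r β a₁ a₂ b₁ b₂ n) α T →
        ENNReal.ofReal (C * (n : ℝ) ^ (-(1 / 2) + β / 2)) ≤
          ⨆ θ ∈ paramSet r β a₁ a₂ b₁ b₂ n, underestimationRisk T θ := by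
  have hb₂ : 0 < b₂ := hb₁.trans hb
  have hw0 : 0 < 1 - b₁ / b₂ := sub_pos.2 ((div_lt_one hb₂).2 hb)
  set w := 1 - b₁ / b₂ with hw
  obtain ⟨d, hd, hmain⟩ := exists_le_iSup_underestimationRisk (r := r) hβ0 ha₁ ha₂ hb₁ hb hα1
  obtain ⟨c, hc0, hc1, hcd, hcb⟩ := exists_pos_le_le_mul_le hd one_pos
    (by positivity : 0 < 128 * b₁)
  have hc2 : c ^ 2 ≤ c := pow_le_of_le_one hc0.le hc1 two_ne_zero
  refine ⟨b₁ / (4 * b₂) * c, by positivity, fun n hn hbn T hT => ?_⟩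
  have hn0 : (0 : ℝ) < n := by positivity
  have hn1 : (1 : ℝ) ≤ n := by exact_mod_cast (by omega : 1 ≤ n)
  set ρ := (n : ℝ) ^ (-(1 / 2) + β / 2) with hρ
  have hρ0 : 0 < ρ := Real.rpow_pos_of_pos hn0 _
  have hρ1 : ρ ≤ 1 := Real.rpow_le_one_of_one_le_of_nonpos hn1 (by linarith)
  set ν := (n : ℝ) ^ (-β) with hν
  have hν0 : 0 < ν := Real.rpow_pos_of_pos hn0 _
  have hw1 : w ≤ 1 - b₁ * ν := one_sub_div_le hb₁.le hb₂ hbn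
  rw [mul_assoc]
  refine hmain n hn hbn (c * ρ) (by positivity)
    ((mul_le_of_le_one_right hc0.le hρ1).trans hcd) 0 le_rfl (by linarith) ?_ T hT
  rw [sub_zero]
  refine (mul_le_mul_of_nonneg_left (integral_signal_le_of_same_mean (by positivity) hw0 hw1 _ _)
    hn0.le).trans ?_
  have hp : (n : ℝ) * ν * ρ ^ 2 = 1 := by
    rw [hν, hρ, ← Real.rpow_mul_natCast hn0.le]
    nth_rewrite 1 [← Real.rpow_one (n : ℝ)]
    rw [← Real.rpow_add hn0, ← Real.rpow_add hn0]
    convert Real.rpow_zero (n : ℝ) using 2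
    push_cast
    ring
  calc _ = b₁ * c ^ 2 * ((n : ℝ) * ν * ρ ^ 2) := by ring
    _ ≤ 1 / 128 := by
      rw [hp, mul_one]
      have : b₁ * c ^ 2 ≤ b₁ * c := by
        gcongr
      linarith

theorem theorem5p2 (r β a₁ a₂ b₁ b₂ α : ℝ)
    (hr0 : 0 < r) (hr1 : r < 1) (hβ0 : 1 / 2 < β) (hβ1 : β < 1)
    (hdet : detectionBoundary β < r)
    (ha₁ : 0 < a₁) (ha₂ : 0 < a₂) (hb₁ : 0 < b₁) (hb : b₁ < b₂)
    (hα0 : 0 < α) (hα1 : α < 1 / 2) :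
    ∃ C : ℝ, 0 < C ∧ ∀ n : ℕ, 2 ≤ n → b₂ * (n : ℝ) ^ (-β) ≤ 1 →
      ENNReal.ofReal (C * lowerRate r β n) ≤
        ⨅ (T : (Fin n → ℝ) → ℝ)
          (_ : IsLowerConfidenceLimit (paramSet r β a₁ a₂ b₁ b₂ n) α T),
          ⨆ θ ∈ paramSet r β a₁ a₂ b₁ b₂ n, underestimationRisk T θ := by
  unfold lowerRate
  split_ifs with h1 h2
  · obtain ⟨C, hC, h⟩ := exists_rate_of_three_mul_le hr0 hβ0
      (sub_half_lt_of_detectionBoundary_lt hβ1 hdet) ha₁ ha₂ hb₁ hb hα1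
    exact ⟨C, hC, fun n hn hbn => le_iInf₂ (h n hn hbn)⟩
  · obtain ⟨C, hC, h⟩ := exists_rate_of_lt_of_lt_three_mul hr0 hβ0 h2 (not_le.1 h1)
      (add_sq_lt_of_detectionBoundary_lt hr0 hr1 (by linarith) hβ1 (not_le.1 h1) hdet)
      ha₁ ha₂ hb₁ hb hα1
    exact ⟨C, hC, fun n hn hbn => le_iInf₂ (h n hn hbn)⟩
  · obtain ⟨C, hC, h⟩ := exists_rate_of_le (r := r) hβ0 hβ1 ha₁ ha₂ hb₁ hb hα1
    exact ⟨C, hC, fun n hn hbn => le_iInf₂ (h n hn hbn)⟩
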